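/- In an M/G/1 FB (Foreground Background) queue with arrival rate $\lambda>0$ and service-time distribution function $F$ (on $[0,\infty)$), customers arrive according to a Poisson process of rate $\lambda$, the service times are i.i.d. with distribution function $F$ and independent of the arrivals, and the system is empty at time $0$. The age of a customer is the amount of service he has received; a customer is present from his arrival until his age equals his service time. At each instant the server, working at rate $1$, serves the youngest customers present: if there are $n$ of them, each is served at rate $1/n$. Let $N(t)$ be the number of customers present at time $t$ and $M(t)=\max_{0\le s\le t}N(s)$. **Theorem 5.1.** Let $M_F(t)$ and $M_G(t)$ be the maximum queue lengths over $[0,t]$ in two M/G/1 FB queues with the same arrival rate $\lambda$ and with service-time distribution functions $F$ and $G$. Assume that $F\wedge p=G\wedge p$ for some $p\in(0,1)$, i.e. $\min(F(x),p)=\min(G(x),p)$ for all $x$. Then $$M_F(t)\le_{st}M_G(t)+K_p(t),\qquad t\ge 0,$$ where $K_p$ is a Poisson process with rate $\lambda(1-p)$, in general dependent on $M_G$. Precisely: there are a probability space and, on it, processes $(\tilde M_F(t))_{t\ge0}$, $(\tilde M_G(t))_{t\ge0}$ with the same laws as $(M_F(t))_{t\ge0}$, $(M_G(t))_{t\ge0}$,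 respectively, and a Poisson process $(K_p(t))_{t\ge 0}$ of rate $\lambda(1-p)$ such that almost surely $\tilde M_F(t)\le \tilde M_G(t)+K_p(t)$ for all $t\ge0$; in particular $P(M_F(t)>x)\le P(\tilde M_G(t)+K_p(t)>x)$ for all $t\ge 0$ and all $x$. -/

import Mathlib

open MeasureTheory ProbabilityTheory
open scoped NNReal ENNReal

noncomputable section

namespace FBQueue

/-! ### The deterministic FB dynamics

`T k` is the arrival time of customer `k`, `B k` his service time, and `A k t` his age at time `t`,
that is, the amount of service he has received up to time `t`. -/

/-- The customers present at time `t`: those who have arrived and whose service is not completed. -/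
def present (T B : ℕ → ℝ) (A : ℕ → ℝ → ℝ) (t : ℝ) : Set ℕ :=
  {k | T k ≤ t ∧ A k t < B k}

/-- The customers in service at time `t`: the youngest among those present. -/
def served (T B : ℕ → ℝ) (A : ℕ → ℝ → ℝ) (t : ℝ) : Set ℕ :=
  {k | k ∈ present T B A t ∧ ∀ j ∈ present T B A t, A k t ≤ A j t}

open Classical in
/-- The rate at which customer `k` is served at time `t`: if there are `n` youngest customers,
each of them is served at rate `1 / n`, and nobody else is served. -/
def serviceRate (T B : ℕ → ℝ) (A : ℕ → ℝ → ℝ) (k : ℕ) (t : ℝ) : ℝ :=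
  if k ∈ served T B A t then 1 / ((served T B A t).ncard : ℝ) else 0

/-- The ages `A` evolve on `[0, ∞)` according to the Foreground Background discipline, the system
being empty before the first arrival. -/
def IsFBPath (T B : ℕ → ℝ) (A : ℕ → ℝ → ℝ) : Prop :=
  ∀ (k : ℕ) (t : ℝ), 0 ≤ t →
    IntervalIntegrable (serviceRate T B A k) volume 0 t ∧
    A k t = ∫ s in (0 : ℝ)..t, serviceRate T B A k s

/-- The queue length at time `t`, in number of customers present. -/
def queueLength (T B : ℕ → ℝ) (A : ℕ → ℝ → ℝ) (t : ℝ) : ℕ∞ :=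
  (present T B A t).encard

/-- The maximum queue length over the time interval `[0, t]`. -/
def maxQueueLength (T B : ℕ → ℝ) (A : ℕ → ℝ → ℝ) (t : ℝ) : ℕ∞ :=
  ⨆ s ∈ Set.Icc (0 : ℝ) t, queueLength T B A s

/-! ### Poisson processes, the M/G/1 FB queue, stochastic order -/

/-- `K` is a (homogeneous) Poisson process of rate `r`: it starts in `0`, has nondecreasing
right-continuous paths, and has independent increments, the increment over `[s, t]` being Poisson
distributed with parameter `r (t - s)`. -/
structure IsPoissonProcess {Ω : Type*} [MeasurableSpace Ω] (P : Measure Ω) (r : ℝ≥0)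
    (K : ℝ≥0 → Ω → ℕ) : Prop where
  aemeasurable : ∀ t, AEMeasurable (K t) P
  zero : ∀ᵐ ω ∂P, K 0 ω = 0
  monotone : ∀ᵐ ω ∂P, Monotone (fun t => K t ω)
  rightContinuous : ∀ᵐ ω ∂P, ∀ t, ContinuousWithinAt (fun u => K u ω) (Set.Ici t) t
  indepIncrements : HasIndepIncrements K P
  increment_law : ∀ s t, s ≤ t →
    HasLaw (fun ω => K t ω - K s ω) (poissonMeasure (r * (t - s))) P

/-- An M/G/1 queue, started empty at time `0`, under the FB discipline, with arrival rate `lam` and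
service-time distribution `F`. The random variables `T k`, `B k` are the arrival and service times
of the `k`-th customer (`k = 0, 1, 2, …`), and `A k t` is his age at time `t`. -/
structure IsMG1FB {Ω : Type*} [MeasurableSpace Ω] (P : Measure Ω) (lam : ℝ≥0) (F : Measure ℝ)
    (T B : ℕ → Ω → ℝ) (A : ℕ → ℝ → Ω → ℝ) : Prop where
  measurable_arrival : ∀ k, Measurable (T k)
  measurable_service : ∀ k, Measurable (B k)
  /-- Customers are numbered in the order of arrival. -/
  arrival_monotone : ∀ᵐ ω ∂P, Monotone (fun k => T k ω)
  arrival_locallyFinite : ∀ᵐ ω ∂P, ∀ t : ℝ, {k | T k ω ≤ t}.Finite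
  /-- The process counting the arrivals is a Poisson process of rate `lam`. -/
  arrival_poisson : IsPoissonProcess P lam (fun t ω => {k | T k ω ≤ (t : ℝ)}.ncard)
  service_nonneg : ∀ k, ∀ᵐ ω ∂P, 0 ≤ B k ω
  service_law : ∀ k, HasLaw (B k) F P
  service_indep : iIndepFun B P
  arrival_indep_service : IndepFun (fun ω k => T k ω) (fun ω k => B k ω) P
  discipline : ∀ᵐ ω ∂P,
    IsFBPath (fun k => T k ω) (fun k => B k ω) (fun k t => A k t ω)

/-- The process `t ↦ M(t)` of the maximum queue length over `[0, t]`, as a function on `Ω`. -/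
def maxProcess {Ω : Type*} (T B : ℕ → Ω → ℝ) (A : ℕ → ℝ → Ω → ℝ) (ω : Ω) (t : ℝ≥0) : ℕ∞ :=
  maxQueueLength (fun k => T k ω) (fun k => B k ω) (fun k s => A k s ω) t

/-- The usual stochastic order `X ≤_st Y` between random variables that may live on different
probability spaces: `P (X > x) ≤ P' (Y > x)` for all `x`. -/
def StochLE {Ω Ω' : Type*} [MeasurableSpace Ω] [MeasurableSpace Ω'] (P : Measure Ω)
    (P' : Measure Ω') (X : Ω → ℕ∞) (Y : Ω' → ℕ∞) : Prop :=
  ∀ x : ℕ∞, P {ω | x < X ω} ≤ P' {ω | x < Y ω}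

end FBQueue

end

/-! Under FB, service below a level `x` has priority over service above it. Hence the work below
level `x` evolves as in a single-server queue with service times `min (B j) x`, whatever the
excesses over `x`. Customer `k` leaves exactly when that queue, with `x = B k`, first empties after
his arrival. His presence at a given arrival epoch therefore depends only on the arrival times and
on the truncated service times `min (B j) (B k)` (`IsFBPath.mem_present_iff`), and the maximum queue
length is a functional of arrival and service times alone (`IsFBPath.maxQueueLength_eq`).

Couple the two queues through common arrivals and common independent uniforms `u k`, with service
times the quantiles of `F` and `G` at `u k`. If `u k < p`, the two service times agree. If `u k ≥
p`, they may differ, but in each queue they are at least as long as those of all customers with `u k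
< p`. Truncation at the service time of such a short customer erases the difference, so short
customers are present in both queues or in neither (`presentAtArrival_congr`). The queue lengths
thus differ by at most the number of long customers that have arrived. The arrivals of long
customers are a thinning of the Poisson process with retention probability `1 - p`
(`IsPoissonProcess.thinning`).

Common arrivals are legitimate because a Poisson counting process determines the law of its ordered
points (`IsPoissonProcess.map_arrivals_eq`). The thinning is proved by joint generating functions of
increments. -/

namespace FBQueue

/-! ### Pathwise analysis of the FB dynamics. -/

section Deterministic

variable {T B : ℕ → ℝ} {A : ℕ → ℝ → ℝ}

theorem serviceRate_nonneg (k : ℕ) (t : ℝ) : 0 ≤ serviceRate T B A k t := by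
  unfold serviceRate; split_ifs <;> positivity

theorem serviceRate_eq_zero {k : ℕ} {t : ℝ} (h : k ∉ served T B A t) :
    serviceRate T B A k t = 0 := by
  simp [serviceRate, h]

theorem present_finite (hT : ∀ t, {k | T k ≤ t}.Finite) (t : ℝ) : (present T B A t).Finite :=
  (hT t).subset fun _ hk => hk.1

theorem served_finite (hT : ∀ t, {k | T k ≤ t}.Finite) (t : ℝ) : (served T B A t).Finite :=
  (present_finite hT t).subset fun _ hk => hk.1

/-- If a finite set of customers contains all those in service, it is served at total rate `1`. -/
theorem sum_serviceRate_eq_one {J : Finset ℕ} {t : ℝ} (hJ : served T B A t ⊆ J)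
    (hne : (served T B A t).Nonempty) : ∑ k ∈ J, serviceRate T B A k t = 1 := by
  classical
  have hfin : (served T B A t).Finite := J.finite_toSet.subset hJ
  have hcard : ((served T B A t).ncard : ℝ) ≠ 0 := by
    simpa [Set.ncard_eq_zero hfin] using hne.ne_empty
  simp only [serviceRate]
  rw [← Finset.sum_filter, Finset.sum_const, nsmul_eq_mul]
  have : J.filter (· ∈ served T B A t) = hfin.toFinset := by
    ext k
    simpa using fun hk => hJ hk
  rw [this, ← Set.ncard_eq_toFinset_card _ hfin]
  field_simp

theorem sum_serviceRate_le_one (hT : ∀ t, {k | T k ≤ t}.Finite) (J : Finset ℕ) (t : ℝ) :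
    ∑ k ∈ J, serviceRate T B A k t ≤ 1 := by
  classical
  by_cases hne : (served T B A t).Nonempty
  · rw [← sum_serviceRate_eq_one (J := J ∪ (served_finite (B := B) (A := A) hT t).toFinset)
      (by simp) hne]
    exact Finset.sum_le_sum_of_subset_of_nonneg Finset.subset_union_left
      fun k _ _ => serviceRate_nonneg k t
  · rw [Finset.sum_eq_zero fun k _ => serviceRate_eq_zero fun hk => hne ⟨k, hk⟩]
    exact zero_le_one

namespace IsFBPath

theorem intervalIntegrable (hA : IsFBPath T B A) (k : ℕ) {s t : ℝ} (hs : 0 ≤ s) (ht : 0 ≤ t) :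
    IntervalIntegrable (serviceRate T B A k) volume s t :=
  (hA k s hs).1.symm.trans (hA k t ht).1

theorem sub_eq_integral (hA : IsFBPath T B A) (k : ℕ) {s t : ℝ} (hs : 0 ≤ s) (ht : 0 ≤ t) :
    A k t - A k s = ∫ u in s..t, serviceRate T B A k u := by
  rw [(hA k s hs).2, (hA k t ht).2]
  exact intervalIntegral.integral_interval_sub_left (hA k t ht).1 (hA k s hs).1

theorem mono (hA : IsFBPath T B A) (k : ℕ) {s t : ℝ} (hs : 0 ≤ s) (hst : s ≤ t) :
    A k s ≤ A k t := by
  rw [← sub_nonneg, hA.sub_eq_integral k hs (hs.trans hst)]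
  exact intervalIntegral.integral_nonneg hst fun u _ => serviceRate_nonneg k u

theorem zero (hA : IsFBPath T B A) (k : ℕ) : A k 0 = 0 := by
  rw [(hA k 0 le_rfl).2, intervalIntegral.integral_same]

theorem nonneg (hA : IsFBPath T B A) (k : ℕ) {t : ℝ} (ht : 0 ≤ t) : 0 ≤ A k t :=
  hA.zero k ▸ hA.mono k le_rfl ht

theorem continuousOn (hA : IsFBPath T B A) (k : ℕ) : ContinuousOn (A k) (Set.Ici 0) := by
  intro t ht
  have ht : (0 : ℝ) ≤ t := ht
  have h : ContinuousOn (A k) (Set.Icc 0 (t + 1)) := by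
    have := intervalIntegral.continuousOn_primitive_interval' (hA k (t + 1) (by linarith)).1
      (a := 0) (by simp)
    rw [Set.uIcc_of_le (by linarith)] at this
    exact this.congr fun s hs => (hA k s hs.1).2
  refine (h t ⟨ht, by linarith⟩).mono_of_mem_nhdsWithin ?_
  filter_upwards [self_mem_nhdsWithin,
    mem_nhdsWithin_of_mem_nhds (Iio_mem_nhds (lt_add_one t))] with s hs hs'
  exact ⟨hs, le_of_lt hs'⟩

theorem eq_of_rate_eq_zero (hA : IsFBPath T B A) (k : ℕ) {a b : ℝ} (ha : 0 ≤ a) (hab : a ≤ b)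
    (h : ∀ u, a < u → u < b → serviceRate T B A k u = 0) : A k b = A k a := by
  rw [← sub_eq_zero, hA.sub_eq_integral k ha (ha.trans hab), intervalIntegral.integral_of_le hab,
    integral_Ioc_eq_integral_Ioo]
  exact setIntegral_eq_zero_of_forall_eq_zero fun u hu => h u hu.1 hu.2

/-- An age stays below the level `c` if service stops above `c`. -/
theorem le_of_rate_eq_zero (hA : IsFBPath T B A) (k : ℕ) {a b c : ℝ} (ha : 0 ≤ a) (hab : a ≤ b)
    (hc : A k a ≤ c) (h : ∀ u, a < u → u < b → c < A k u → serviceRate T B A k u = 0) :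
    A k b ≤ c := by
  have hcomp : IsCompact {s ∈ Set.Icc a b | A k s ≤ c} := by
    refine isCompact_Icc.of_isClosed_subset ?_ (Set.sep_subset _ _)
    exact ((hA.continuousOn k).mono fun s hs => ha.trans hs.1).preimage_isClosed_of_isClosed
      isClosed_Icc isClosed_Iic
  -- `σ` is the last time the age is at most `c`; there is no service afterwards, so the age is
  -- still `A k σ` at `b`.
  obtain ⟨σ, ⟨⟨haσ, hσb⟩, hσ⟩, hmax⟩ := hcomp.exists_isGreatest ⟨a, ⟨le_rfl, hab⟩, hc⟩
  rw [hA.eq_of_rate_eq_zero k (ha.trans haσ) hσb]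
  · exact hσ
  · intro u hu hub
    refine h u (haσ.trans_lt hu) hub ?_
    by_contra hcu
    exact absurd (hmax ⟨⟨haσ.trans hu.le, hub.le⟩, not_lt.1 hcu⟩) (not_le.2 hu)

theorem eq_zero_of_le_arrival (hA : IsFBPath T B A) {k : ℕ} {t : ℝ} (ht : 0 ≤ t) (htk : t ≤ T k) :
    A k t = 0 := by
  rw [← hA.zero k]
  refine hA.eq_of_rate_eq_zero k le_rfl ht fun u _ hu => serviceRate_eq_zero fun hk => ?_
  have := hk.1.1
  linarith

theorem le_service (hA : IsFBPath T B A) (hB : ∀ k, 0 ≤ B k) (k : ℕ) {t : ℝ} (ht : 0 ≤ t) :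
    A k t ≤ B k := by
  refine hA.le_of_rate_eq_zero k le_rfl ht (by rw [hA.zero]; exact hB k) fun u _ _ hu =>
    serviceRate_eq_zero fun hk => ?_
  have := hk.1.2
  linarith

/-- Together, customers arriving not before `r` receive at most `s - r` service up to time `s`. -/
theorem sum_age_le (hA : IsFBPath T B A) (hT : ∀ t, {k | T k ≤ t}.Finite) (J : Finset ℕ) {r s : ℝ}
    (hr : 0 ≤ r) (hrs : r ≤ s) (hJ : ∀ j ∈ J, r ≤ T j) : ∑ j ∈ J, A j s ≤ s - r := by
  have h : ∑ j ∈ J, A j s = ∫ u in r..s, ∑ j ∈ J, serviceRate T B A j u := by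
    rw [intervalIntegral.integral_finsetSum fun j _ =>
      hA.intervalIntegrable j hr (hr.trans hrs)]
    refine Finset.sum_congr rfl fun j hj => ?_
    rw [← hA.sub_eq_integral j hr (hr.trans hrs), hA.eq_zero_of_le_arrival hr (hJ j hj), sub_zero]
  rw [h]
  calc ∫ u in r..s, ∑ j ∈ J, serviceRate T B A j u ≤ ∫ _ in r..s, (1 : ℝ) := by
        refine intervalIntegral.integral_mono_on hrs ?_ intervalIntegrable_const
          fun u _ => sum_serviceRate_le_one hT J u
        simpa only [Finset.sum_fn] using
          IntervalIntegrable.sum J fun j _ => hA.intervalIntegrable j hr (hr.trans hrs)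
    _ = s - r := by simp

/-- When customer `k` leaves, all others have been served up to level `B k`. -/
theorem exists_level_reached (hA : IsFBPath T B A) (hT0 : ∀ k, 0 < T k) {k : ℕ} (hk : 0 < B k)
    {t : ℝ} (ht : 0 ≤ t) (h : B k ≤ A k t) :
    ∃ s, T k < s ∧ s ≤ t ∧ ∀ j, T j < s → min (B j) (B k) ≤ A j s := by
  have hcomp : IsCompact {s ∈ Set.Icc 0 t | B k ≤ A k s} := by
    refine isCompact_Icc.of_isClosed_subset ?_ (Set.sep_subset _ _)
    exact ((hA.continuousOn k).mono fun s hs => hs.1).preimage_isClosed_of_isClosed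
      isClosed_Icc isClosed_Ici
  -- `s` is the departure time of `k`.
  obtain ⟨s, ⟨⟨hs0, hst⟩, hs⟩, hmin⟩ := hcomp.exists_isLeast ⟨t, ⟨ht, le_rfl⟩, h⟩
  have hlt : ∀ u, 0 ≤ u → u < s → A k u < B k := fun u hu hus => by
    by_contra hc
    exact absurd (hmin ⟨⟨hu, hus.le.trans hst⟩, not_lt.1 hc⟩) (not_le.2 hus)
  refine ⟨s, ?_, hst, fun j hj => ?_⟩
  · by_contra hc
    rw [hA.eq_zero_of_le_arrival hs0 (not_lt.1 hc)] at hs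
    linarith
  · by_contra! hc
    obtain ⟨hjB, hjk⟩ := lt_min_iff.1 hc
    -- If `j` lags behind, it is present on the whole of `(T j, s)` with age at most `A j s`, which
    -- blocks service of `k` above this maximum: `k` could not have reached `B k` at time `s`.
    have hmax : max (A j s) (A k (T j)) < B k := max_lt hjk (hlt _ (hT0 j).le hj)
    refine absurd (hA.le_of_rate_eq_zero k (hT0 j).le hj.le (le_max_right (A j s) _) ?_)
      (not_le.2 (hmax.trans_le hs))
    intro u hju hus hu
    refine serviceRate_eq_zero fun hsrv => ?_
    have hmono := hA.mono j ((hT0 j).le.trans hju.le) hus.le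
    have := hsrv.2 j ⟨hju.le, by linarith⟩
    have := (max_lt_iff.1 hu).1
    linarith

/-- As long as customer `k` is present, the work below level `B k` brought in by some initial
arrival and those following it exceeds the time elapsed. -/
theorem exists_work_gt (hA : IsFBPath T B A) (hT : ∀ t, {k | T k ≤ t}.Finite) (hT0 : ∀ k, 0 < T k)
    (hB : ∀ k, 0 ≤ B k) {k : ℕ} {s : ℝ} (hks : T k < s) (h : A k s < B k) :
    ∃ i, T i ≤ T k ∧ ∀ J : Finset ℕ, (∀ j, j ∈ J ↔ T i ≤ T j ∧ T j < s) →
      s - T i < ∑ j ∈ J, min (B j) (B k) := by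
  -- `Z` consists of the times up to `T k` at which no work below level `B k` is left from earlier
  -- arrivals. Its supremum `r` starts the busy period, at this level, that contains the arrival of
  -- `k`.
  set Z : Set ℝ := {u | 0 ≤ u ∧ u ≤ T k ∧ ∀ j, T j < u → min (B j) (B k) ≤ A j u}
  have hZ0 : (0 : ℝ) ∈ Z := ⟨le_rfl, (hT0 k).le, fun j hj => absurd hj (not_lt.2 (hT0 j).le)⟩
  have hZb : BddAbove Z := ⟨T k, fun u hu => hu.2.1⟩
  set r := sSup Z
  have hr0 : 0 ≤ r := le_csSup hZb hZ0
  have hrk : r ≤ T k := csSup_le ⟨0, hZ0⟩ fun u hu => hu.2.1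
  have hrZ : ∀ j, T j < r → min (B j) (B k) ≤ A j r := fun j hj => by
    obtain ⟨u, hu, hju⟩ := exists_lt_of_lt_csSup ⟨0, hZ0⟩ hj
    exact (hu.2.2 j hju).trans (hA.mono j hu.1 (le_csSup hZb hu))
  have hrs : r ≤ s := hrk.trans hks.le
  have hs0 : 0 ≤ s := hr0.trans hrs
  have hfin : {j | r ≤ T j ∧ T j < s}.Finite := (hT s).subset fun j hj => hj.2.le
  set J := hfin.toFinset
  have hJ : ∀ j, j ∈ J ↔ r ≤ T j ∧ T j < s := fun j => by simp [J]
  have hkJ : k ∈ J := (hJ k).2 ⟨hrk, hks⟩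
  have hlow : ∀ u, r < u → u < s → ∃ j, T j ≤ u ∧ A j u < min (B j) (B k) := by
    intro u hru hus
    rcases le_or_gt u (T k) with huk | huk
    · by_contra! hc
      exact absurd (le_csSup hZb (show u ∈ Z from ⟨hr0.trans hru.le, huk, fun j hj => hc j hj.le⟩))
        (not_le.2 hru)
    · refine ⟨k, huk.le, ?_⟩
      rw [min_self]
      exact (hA.mono k (hr0.trans hru.le) hus.le).trans_lt h
  have hserved : ∀ u, r < u → u < s → ∀ j ∈ served T B A u, A j u < B k := by
    intro u hru hus j hj
    obtain ⟨i, hiu, hi⟩ := hlow u hru hus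
    obtain ⟨hiB, hik⟩ := lt_min_iff.1 hi
    exact (hj.2 i ⟨hiu, hiB⟩).trans_lt hik
  -- During the busy period the server works at full rate below level `B k`, and customers from
  -- before `r` need nothing more there.
  have hone : ∀ u, r < u → u < s → ∑ j ∈ J, serviceRate T B A j u = 1 := by
    intro u hru hus
    refine sum_serviceRate_eq_one (fun j hj => ?_) ?_
    · refine (hJ j).2 ⟨?_, hj.1.1.trans_lt hus⟩
      by_contra! hjr
      have h1 := (hrZ j hjr).trans (hA.mono j hr0 hru.le)
      exact absurd (lt_min hj.1.2 (hserved u hru hus j hj)) (not_lt.2 h1)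
    · obtain ⟨i, hiu, hi⟩ := hlow u hru hus
      obtain ⟨j, hj, hjmin⟩ := Set.exists_min_image _ (fun j => A j u)
        (present_finite (B := B) (A := A) hT u) ⟨i, hiu, (lt_min_iff.1 hi).1⟩
      exact ⟨j, hj, hjmin⟩
  have hsum : ∑ j ∈ J, A j s = s - r := by
    have h1 : ∑ j ∈ J, A j s = ∫ u in r..s, ∑ j ∈ J, serviceRate T B A j u := by
      rw [intervalIntegral.integral_finsetSum fun j _ => hA.intervalIntegrable j hr0 hs0]
      refine Finset.sum_congr rfl fun j hj => ?_
      rw [← hA.sub_eq_integral j hr0 hs0, hA.eq_zero_of_le_arrival hr0 ((hJ j).1 hj).1, sub_zero]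
    rw [h1, intervalIntegral.integral_of_le hrs, integral_Ioc_eq_integral_Ioo,
      setIntegral_congr_fun measurableSet_Ioo fun u hu => hone u hu.1 hu.2]
    simp [hrs]
  have hle : ∀ j ∈ J, A j s ≤ min (B j) (B k) := by
    intro j hj
    refine le_min (hA.le_service hB j hs0) ?_
    refine hA.le_of_rate_eq_zero j hr0 hrs ?_ fun u hru hus hu =>
      serviceRate_eq_zero fun hsrv => absurd (hserved u hru hus j hsrv) (not_lt.2 hu.le)
    rw [hA.eq_zero_of_le_arrival hr0 ((hJ j).1 hj).1]
    exact hB k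
  have hlt : s - r < ∑ j ∈ J, min (B j) (B k) := by
    rw [← hsum]
    exact Finset.sum_lt_sum hle ⟨k, hkJ, by rwa [min_self]⟩
  -- Replacing `r` by the first arrival at or after `r` keeps the same customers and can only
  -- shorten the elapsed time.
  obtain ⟨i, hi, himin⟩ := J.exists_min_image T ⟨k, hkJ⟩
  refine ⟨i, himin k hkJ, fun J' hJ' => ?_⟩
  have : J' = J := by
    ext j
    rw [hJ', hJ]
    refine ⟨fun hj => ⟨((hJ i).1 hi).1.trans hj.1, hj.2⟩, fun hj => ⟨himin j ((hJ j).2 hj), hj.2⟩⟩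
  rw [this]
  have := ((hJ i).1 hi).1
  linarith

end IsFBPath

/-! ### Queue lengths as functionals of arrival and service times. -/

open Classical in
/-- The work that the customers arriving in `[a, b)` bring in below level `x`. -/
noncomputable def workBelow (T B : ℕ → ℝ) (x a b : ℝ) : ℝ≥0∞ :=
  ∑' j, if a ≤ T j ∧ T j < b then ENNReal.ofReal (min (B j) x) else 0

theorem workBelow_eq_sum (hB : ∀ k, 0 ≤ B k) {x a b : ℝ} (hx : 0 ≤ x) {J : Finset ℕ}
    (hJ : ∀ j, j ∈ J ↔ a ≤ T j ∧ T j < b) :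
    workBelow T B x a b = ENNReal.ofReal (∑ j ∈ J, min (B j) x) := by
  classical
  rw [ENNReal.ofReal_sum_of_nonneg fun j _ => le_min (hB j) hx, workBelow,
    tsum_eq_sum (s := J) fun j hj => if_neg fun h => hj ((hJ j).2 h)]
  exact Finset.sum_congr rfl fun j hj => if_pos ((hJ j).1 hj)

/-- Customer `k` has arrived, but not yet left, when customer `m` arrives: the arrival and service
times alone decide. -/
def PresentAtArrival (T B : ℕ → ℝ) (m k : ℕ) : Prop :=
  T k ≤ T m ∧ 0 < B k ∧ ∀ l, T k < T l → T l ≤ T m →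
    ∃ i, T i ≤ T k ∧ ENNReal.ofReal (T l - T i) < workBelow T B (B k) (T i) (T l)

open Classical in
/-- The maximum queue length over `[0, t]` in terms of arrival and service times: it is attained at
an arrival. -/
noncomputable def maxAtArrivals (T B : ℕ → ℝ) (t : ℝ) : ℕ∞ :=
  ⨆ m, if T m ≤ t then {k | PresentAtArrival T B m k}.encard else 0

/-- The truncated workload is a supremum over starting arrivals `i` of work brought in minus time
elapsed. Positivity needs testing only at arrival epochs `l`: once the level has been cleared at
some time `s`, it is still clear just before the first arrival at or after `s`. -/
theorem IsFBPath.mem_present_iff (hA : IsFBPath T B A) (hT : ∀ t, {k | T k ≤ t}.Finite)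
    (hT0 : ∀ k, 0 < T k) (hB : ∀ k, 0 ≤ B k) (m k : ℕ) :
    k ∈ present T B A (T m) ↔ PresentAtArrival T B m k := by
  have hfin : ∀ a b, {j | a ≤ T j ∧ T j < b}.Finite := fun a b =>
    (hT b).subset fun j hj => hj.2.le
  have hJ : ∀ a b j, j ∈ (hfin a b).toFinset ↔ a ≤ T j ∧ T j < b := fun a b j => by simp
  constructor
  · rintro ⟨hkm, hk⟩
    refine ⟨hkm, (hA.nonneg k (hT0 m).le).trans_lt hk, fun l hkl hlm => ?_⟩
    obtain ⟨i, hik, hi⟩ := hA.exists_work_gt hT hT0 hB hkl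
      ((hA.mono k (hT0 l).le hlm).trans_lt hk)
    refine ⟨i, hik, ?_⟩
    rw [workBelow_eq_sum hB (hB k) (hJ _ _)]
    exact (ENNReal.ofReal_lt_ofReal_iff_of_nonneg (by linarith)).2 (hi _ (hJ _ _))
  · rintro ⟨hkm, hk, h⟩
    refine ⟨hkm, ?_⟩
    by_contra! hc
    obtain ⟨s, hks, hsm, hs⟩ := hA.exists_level_reached hT0 hk (hT0 m).le hc
    obtain ⟨l, ⟨hlm, hsl⟩, hlmin⟩ := Set.exists_min_image {l | T l ≤ T m ∧ s ≤ T l} T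
      ((hT (T m)).subset fun l hl => hl.1) ⟨m, le_rfl, hsm⟩
    obtain ⟨i, hik, hi⟩ := h l (hks.trans_le hsl) hlm
    refine absurd hi (not_lt.2 ?_)
    rw [workBelow_eq_sum hB (hB k) (hJ _ _)]
    refine ENNReal.ofReal_le_ofReal ?_
    -- No customer arrives in `[s, T l)` by the choice of `l`, so all the work counted was already
    -- done by time `s`.
    have hsub : ∀ j ∈ (hfin (T i) (T l)).toFinset, T i ≤ T j ∧ T j < s := fun j hj => by
      obtain ⟨h1, h2⟩ := (hJ _ _ _).1 hj
      refine ⟨h1, ?_⟩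
      by_contra! hc
      exact absurd (hlmin j ⟨h2.le.trans hlm, hc⟩) (not_le.2 h2)
    calc ∑ j ∈ (hfin (T i) (T l)).toFinset, min (B j) (B k)
        ≤ ∑ j ∈ (hfin (T i) (T l)).toFinset, A j s :=
          Finset.sum_le_sum fun j hj => hs j (hsub j hj).2
      _ ≤ s - T i := hA.sum_age_le hT _ (hT0 i).le (hik.trans hks.le) fun j hj => (hsub j hj).1
      _ ≤ T l - T i := by linarith

/-- Between arrivals customers can only leave, so the queue at time `s` is contained in the one at
the last arrival before or at `s`. -/
theorem IsFBPath.maxQueueLength_eq (hA : IsFBPath T B A) (hT : ∀ t, {k | T k ≤ t}.Finite)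
    (hT0 : ∀ k, 0 < T k) (hB : ∀ k, 0 ≤ B k) (t : ℝ) :
    maxQueueLength T B A t = maxAtArrivals T B t := by
  classical
  have hset : ∀ m, {k | PresentAtArrival T B m k} = present T B A (T m) := fun m =>
    Set.ext fun k => (hA.mem_present_iff hT hT0 hB m k).symm
  unfold maxQueueLength maxAtArrivals
  refine le_antisymm (iSup₂_le fun s hs => ?_) (iSup_le fun m => ?_)
  · rcases Set.eq_empty_or_nonempty (present T B A s) with h | ⟨i, hi⟩
    · simp [queueLength, h]
    · obtain ⟨m, hm, hmax⟩ := Set.exists_max_image _ T (hT s) ⟨i, hi.1⟩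
      refine le_trans ?_ (le_iSup _ m)
      rw [if_pos (le_trans hm hs.2), hset]
      exact Set.encard_le_encard fun k hk =>
        ⟨hmax k hk.1, (hA.mono k (hT0 m).le hm).trans_lt hk.2⟩
  · split_ifs with h
    · rw [hset]
      exact le_iSup₂_of_le (T m) ⟨(hT0 m).le, h⟩ le_rfl
    · exact zero_le

end Deterministic

/-! ### Measurability of the maximum queue length functional. -/

section Measurability

theorem measurable_workBelow (k i l : ℕ) :
    Measurable fun x : (ℕ → ℝ) × (ℕ → ℝ) => workBelow x.1 x.2 (x.2 k) (x.1 i) (x.1 l) := by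
  classical
  unfold workBelow
  refine Measurable.tsum fun j => Measurable.ite ?_ (by fun_prop) measurable_const
  have hle : MeasurableSet {x : (ℕ → ℝ) × (ℕ → ℝ) | x.1 i ≤ x.1 j} :=
    measurableSet_le (by fun_prop) (by fun_prop)
  have hlt : MeasurableSet {x : (ℕ → ℝ) × (ℕ → ℝ) | x.1 j < x.1 l} :=
    measurableSet_lt (by fun_prop) (by fun_prop)
  exact hle.inter hlt

theorem measurable_presentAtArrival (m k : ℕ) :
    Measurable fun x : (ℕ → ℝ) × (ℕ → ℝ) => PresentAtArrival x.1 x.2 m k := by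
  unfold PresentAtArrival
  have hle : ∀ i j, Measurable fun x : (ℕ → ℝ) × (ℕ → ℝ) => x.1 i ≤ x.1 j := fun i j =>
    measurableSet_setOfPred.1 (measurableSet_le (by fun_prop) (by fun_prop))
  have hlt : ∀ i j, Measurable fun x : (ℕ → ℝ) × (ℕ → ℝ) => x.1 i < x.1 j := fun i j =>
    measurableSet_setOfPred.1 (measurableSet_lt (by fun_prop) (by fun_prop))
  refine (hle k m).and (Measurable.and ?_ (Measurable.forall fun l => (hlt k l).imp ((hle l m).imp
    (Measurable.exists fun i => (hle i k).and ?_))))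
  · exact measurableSet_setOfPred.1 (measurableSet_lt (by fun_prop) (by fun_prop))
  · exact measurableSet_setOfPred.1 (measurableSet_lt (by fun_prop) (measurable_workBelow k i l))

theorem measurable_maxAtArrivals :
    Measurable fun (x : (ℕ → ℝ) × (ℕ → ℝ)) (t : ℝ≥0) => maxAtArrivals x.1 x.2 t := by
  classical
  refine measurable_pi_lambda _ fun t => ?_
  unfold maxAtArrivals
  have h : ∀ m, Measurable fun x : (ℕ → ℝ) × (ℕ → ℝ) =>
      if x.1 m ≤ t then {k | PresentAtArrival x.1 x.2 m k}.encard else 0 := fun m =>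
    Measurable.ite (measurableSet_le (by fun_prop) (by fun_prop))
      (measurable_encard.comp (measurable_set_iff.2 fun k => measurable_presentAtArrival m k))
      measurable_const
  refine measurable_to_countable' fun n => ?_
  have hle : ∀ n : ℕ∞, MeasurableSet {x : (ℕ → ℝ) × (ℕ → ℝ) |
      ⨆ m, (if x.1 m ≤ t then {k | PresentAtArrival x.1 x.2 m k}.encard else 0) ≤ n} := fun n => by
    simp only [iSup_le_iff, Set.ofPred_forall]
    exact MeasurableSet.iInter fun m => h m (MeasurableSet.of_discrete (s := Set.Iic n))
  -- `ℕ∞` is countable, so singletons suffice, and they are built from the sets `Iic`, whose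
  -- preimages under a supremum are intersections.
  have : {n} = Set.Iic n \ ⋃ i : {i // i < n}, Set.Iic i.1 := by
    ext i
    simp only [Set.mem_singleton_iff, Set.mem_sdiff, Set.mem_Iic, Set.mem_iUnion, Subtype.exists,
      exists_prop, not_exists, not_and, not_le]
    refine ⟨?_, fun ⟨h1, h2⟩ => ?_⟩
    · rintro rfl
      exact ⟨le_rfl, fun _ h => h⟩
    · by_contra hne
      exact absurd (h2 i (lt_of_le_of_ne h1 hne)) (lt_irrefl _)
  rw [this, Set.preimage_sdiff, Set.preimage_iUnion]
  exact (hle n).diff (MeasurableSet.iUnion fun i => hle i)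

end Measurability

/-! ### Pathwise comparison of two service sequences. -/

section Coupling

variable {T B C : ℕ → ℝ} {S : Set ℕ}

/-- Customers in `S` enter only through their service times truncated at `B k = C k`, and both
truncations equal that level. -/
theorem presentAtArrival_congr (h : ∀ k ∉ S, B k = C k)
    (hS : ∀ k ∉ S, ∀ j ∈ S, B k ≤ B j ∧ C k ≤ C j) {m k : ℕ} (hk : k ∉ S) :
    PresentAtArrival T B m k ↔ PresentAtArrival T C m k := by
  have hmin : ∀ j, min (B j) (C k) = min (C j) (C k) := fun j => by
    by_cases hj : j ∈ S
    · rw [← h k hk, min_eq_right (hS k hk j hj).1, h k hk, min_eq_right (hS k hk j hj).2]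
    · rw [h j hj]
  simp only [PresentAtArrival, workBelow, h k hk, hmin]

/-- If the customers outside `S` have the same service times `B = C`, and those in `S` have longer
service times both in `B` and in `C`, then changing `B` to `C` affects the maximum queue length by
at most the number of customers in `S`. -/
theorem maxAtArrivals_le_add (h : ∀ k ∉ S, B k = C k)
    (hS : ∀ k ∉ S, ∀ j ∈ S, B k ≤ B j ∧ C k ≤ C j) (t : ℝ) :
    maxAtArrivals T B t ≤ maxAtArrivals T C t + {k | T k ≤ t ∧ k ∈ S}.encard := by
  classical
  refine iSup_le fun m => ?_
  split_ifs with hm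
  · calc {k | PresentAtArrival T B m k}.encard
        ≤ ({k | PresentAtArrival T C m k} ∪ {k | T k ≤ t ∧ k ∈ S}).encard := by
          refine Set.encard_le_encard fun k hk => ?_
          by_cases hkS : k ∈ S
          · exact Or.inr ⟨le_trans hk.1 hm, hkS⟩
          · exact Or.inl ((presentAtArrival_congr h hS hkS).1 hk)
      _ ≤ {k | PresentAtArrival T C m k}.encard + {k | T k ≤ t ∧ k ∈ S}.encard :=
          Set.encard_union_le _ _
      _ ≤ _ := by
          gcongr
          unfold maxAtArrivals
          exact le_iSup_of_le m (by rw [if_pos hm])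
  · exact zero_le

end Coupling

/-! ### Quantile coupling of the service times. -/

section Quantile

open Classical in
/-- The quantile function of a probability measure on `ℝ`, extended by `0` outside `(0, 1)`. -/
noncomputable def quantile (F : Measure ℝ) (u : ℝ) : ℝ :=
  if u ∈ Set.Ioo (0 : ℝ) 1 then sInf {x | u ≤ cdf F x} else 0

variable (F G : Measure ℝ)

/-- Right continuity of the distribution function makes the infimum attained. Measurability, law and
comparison of quantiles all follow from this equivalence. -/
theorem quantile_le_iff {u : ℝ} (hu : u ∈ Set.Ioo (0 : ℝ) 1) (x : ℝ) :
    quantile F u ≤ x ↔ u ≤ cdf F x := by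
  have hne : {x | u ≤ cdf F x}.Nonempty :=
    (((tendsto_cdf_atTop F).eventually (lt_mem_nhds hu.2)).exists).imp fun _ h => le_of_lt h
  obtain ⟨y, hy⟩ := ((tendsto_cdf_atBot F).eventually (gt_mem_nhds hu.1)).exists
  have hbdd : BddBelow {x | u ≤ cdf F x} := ⟨y, fun x hx => by
    by_contra! hc
    exact absurd ((monotone_cdf F hc.le).trans_lt hy) (not_lt.2 hx)⟩
  rw [quantile, if_pos hu]
  refine ⟨fun h => ?_, fun h => csInf_le hbdd h⟩
  have hgt : ∀ y, x < y → u ≤ cdf F y := fun y hy => by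
    obtain ⟨z, hz, hzy⟩ := exists_lt_of_csInf_lt hne (h.trans_lt hy)
    exact le_trans hz (monotone_cdf F hzy.le)
  have hr : Filter.Tendsto (cdf F) (nhdsWithin x (Set.Ioi x)) (nhds (cdf F x)) :=
    ((cdf F).right_continuous x).mono_left (nhdsWithin_mono _ Set.Ioi_subset_Ici_self)
  exact ge_of_tendsto hr (Filter.eventually_of_mem self_mem_nhdsWithin fun y hy => hgt y hy)

theorem measurable_quantile : Measurable (quantile F) := by
  refine measurable_of_Iic fun x => ?_
  have : quantile F ⁻¹' Set.Iic x =
      (Set.Ioo 0 1 ∩ Set.Iic (cdf F x)) ∪ ((Set.Ioo 0 1)ᶜ ∩ {_u | 0 ≤ x}) := by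
    ext u
    by_cases hu : u ∈ Set.Ioo (0 : ℝ) 1
    · simp only [Set.mem_preimage, Set.mem_Iic, quantile_le_iff F hu, Set.mem_union,
        Set.mem_inter_iff, hu, Set.mem_compl_iff, true_and, not_true, false_and, or_false]
    · simp only [Set.mem_preimage, Set.mem_Iic, quantile, hu, if_false, Set.mem_union,
        Set.mem_inter_iff, Set.mem_compl_iff, not_false_iff, true_and, false_and, false_or,
        Set.mem_ofPred_eq]
  rw [this]
  exact (measurableSet_Ioo.inter measurableSet_Iic).union
    (measurableSet_Ioo.compl.inter (MeasurableSet.const _))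

/-- The uniform distribution on `(0, 1)`. -/
noncomputable def uniform01 : Measure ℝ := volume.restrict (Set.Ioo 0 1)

instance : IsProbabilityMeasure uniform01 := ⟨by simp [uniform01]⟩

theorem ae_uniform01 : ∀ᵐ u ∂uniform01, u ∈ Set.Ioo (0 : ℝ) 1 :=
  ae_restrict_mem measurableSet_Ioo

theorem map_quantile_uniform01 [IsProbabilityMeasure F] : uniform01.map (quantile F) = F := by
  have : IsProbabilityMeasure (uniform01.map (quantile F)) :=
    Measure.isProbabilityMeasure_map (measurable_quantile F).aemeasurable
  refine Measure.ext_of_Iic _ _ fun x => ?_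
  rw [Measure.map_apply (measurable_quantile F) measurableSet_Iic, ← ofReal_cdf F x, uniform01,
    Measure.restrict_apply (measurable_quantile F measurableSet_Iic)]
  have : quantile F ⁻¹' Set.Iic x ∩ Set.Ioo 0 1 = Set.Iic (cdf F x) ∩ Set.Ioo 0 1 := by
    ext u
    refine and_congr_left fun hu => ?_
    exact quantile_le_iff F hu x
  rw [this]
  refine le_antisymm ?_ ?_
  · calc volume (Set.Iic (cdf F x) ∩ Set.Ioo 0 1) ≤ volume (Set.Ioc 0 (cdf F x)) :=
          measure_mono fun u hu => ⟨hu.2.1, hu.1⟩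
      _ = ENNReal.ofReal (cdf F x) := by simp
  · calc ENNReal.ofReal (cdf F x) = volume (Set.Ioo 0 (cdf F x)) := by simp
      _ ≤ volume (Set.Iic (cdf F x) ∩ Set.Ioo 0 1) :=
          measure_mono fun u hu => ⟨hu.2.le, hu.1, hu.2.trans_le (cdf_le_one F x)⟩

variable {F G} {p : ℝ}

theorem quantile_congr (hFG : ∀ x, min (cdf F x) p = min (cdf G x) p) {u : ℝ}
    (hu : u ∈ Set.Ioo (0 : ℝ) 1) (hup : u ≤ p) : quantile F u = quantile G u := by
  have h : ∀ x, u ≤ cdf F x ↔ u ≤ cdf G x := fun x => by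
    have := hFG x
    constructor <;> intro h
    · exact (le_min_iff.1 (this ▸ le_min h hup)).1
    · exact (le_min_iff.1 (this.symm ▸ le_min h hup)).1
  refine eq_of_forall_ge_iff fun x => ?_
  rw [quantile_le_iff F hu, quantile_le_iff G hu, h]

theorem quantile_mono {u v : ℝ} (hu : u ∈ Set.Ioo (0 : ℝ) 1) (hv : v ∈ Set.Ioo (0 : ℝ) 1)
    (huv : u ≤ v) : quantile F u ≤ quantile F v :=
  (quantile_le_iff F hu _).2 (huv.trans ((quantile_le_iff F hv _).1 le_rfl))

end Quantile

/-! ### Poisson increments and their generating functions. -/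

section PoissonTransform

open Complex

theorem integral_pow_poissonMeasure (r : ℝ≥0) (w : ℂ) :
    ∫ n, w ^ n ∂(poissonMeasure r) = cexp (r * (w - 1)) := by
  rw [integral_poissonMeasure]
  calc ∑' n : ℕ, (Real.exp (-r) * (r : ℝ) ^ n / (n.factorial : ℝ)) • w ^ n
      = ∑' n : ℕ, (Real.exp (-r) : ℂ) * ((r * w) ^ n / n.factorial) := by
        congr with n
        rw [Complex.real_smul]
        push_cast
        ring
    _ = (Real.exp (-r) : ℂ) * cexp (r * w) := by
        rw [tsum_mul_left, (NormedSpace.expSeries_div_hasSum_exp ((r : ℂ) * w)).tsum_eq,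
          exp_eq_exp_ℂ]
    _ = cexp (r * (w - 1)) := by
        rw [ofReal_exp, ← Complex.exp_add]
        push_cast
        ring_nf

variable {Ω : Type*} [MeasurableSpace Ω] {P : Measure Ω} {r : ℝ≥0} {K : ℝ≥0 → Ω → ℕ}

/-- Arbitrary complex `w` is allowed because thinning evaluates this at `1 + q (z - 1)`, in general
off the unit circle. -/
theorem IsPoissonProcess.integral_prod_pow (h : IsPoissonProcess P r K) {n : ℕ}
    {t : Fin (n + 1) → ℝ≥0} (ht : Monotone t) (w : Fin n → ℂ) :
    ∫ ω, ∏ i, w i ^ (K (t i.succ) ω - K (t i.castSucc) ω) ∂P =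
      ∏ i : Fin n, cexp ((r * (t i.succ - t i.castSucc) : ℝ≥0) * (w i - 1)) := by
  rw [(h.indepIncrements n t ht).integral_fun_prod_comp (f := fun i m => w i ^ m)
    (fun i => (h.increment_law _ _ (ht i.castSucc_lt_succ.le)).aemeasurable)
    (fun i => .of_discrete)]
  refine Finset.prod_congr rfl fun i _ => ?_
  rw [← integral_pow_poissonMeasure]
  exact (h.increment_law _ _ (ht i.castSucc_lt_succ.le)).integral_comp .of_discrete

/-- A sufficient condition for the increments of a process to be independent and Poisson
distributed, in terms of the characteristic functions. -/
theorem indepIncrements_and_law_of_integral_prod_pow [IsProbabilityMeasure P]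
    (hK : ∀ t, AEMeasurable (K t) P)
    (h : ∀ (n : ℕ) (t : Fin (n + 1) → ℝ≥0), Monotone t → ∀ z : Fin n → ℂ, (∀ i, ‖z i‖ = 1) →
      ∫ ω, ∏ i, z i ^ (K (t i.succ) ω - K (t i.castSucc) ω) ∂P =
        ∏ i : Fin n, cexp ((r * (t i.succ - t i.castSucc) : ℝ≥0) * (z i - 1))) :
    HasIndepIncrements K P ∧
      ∀ s t, s ≤ t → HasLaw (fun ω => K t ω - K s ω) (poissonMeasure (r * (t - s))) P := by
  have hD : ∀ s t, AEMeasurable (fun ω => K t ω - K s ω) P := fun s t =>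
    (measurable_of_countable fun x : ℕ × ℕ => x.1 - x.2).comp_aemeasurable
      ((hK t).prodMk (hK s))
  have hDR : ∀ s t, AEMeasurable (fun ω => ((K t ω - K s ω : ℕ) : ℝ)) P := fun s t =>
    (measurable_of_countable (Nat.cast : ℕ → ℝ)).comp_aemeasurable (hD s t)
  have hexp : ∀ (m : ℕ) (θ : ℝ), cexp ((m : ℝ) * θ * I) = cexp (θ * I) ^ m := fun m θ => by
    rw [← Complex.exp_nat_mul]
    push_cast
    ring_nf
  have hchar : ∀ s t, s ≤ t → ∀ θ : ℝ,
      charFun (P.map fun ω => ((K t ω - K s ω : ℕ) : ℝ)) θ =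
        cexp ((r * (t - s) : ℝ≥0) * (cexp (θ * I) - 1)) := by
    intro s t hst θ
    have := h 1 ![s, t] (by
      intro i j hij
      fin_cases i <;> fin_cases j <;> simp_all) (fun _ => cexp (θ * I))
      fun _ => norm_exp_ofReal_mul_I θ
    simp only [Finset.univ_unique, Fin.default_eq_zero, Finset.prod_singleton, Fin.succ_zero_eq_one,
      Fin.castSucc_zero, Matrix.cons_val_one, Matrix.cons_val_zero, Fin.isValue] at this
    rw [← this, charFun_apply_real, integral_map (hDR s t) (by fun_prop)]
    refine integral_congr_ae (Filter.Eventually.of_forall fun ω => ?_)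
    simp only
    rw [mul_comm (θ : ℂ), hexp]
  have hlaw : ∀ s t, s ≤ t →
      HasLaw (fun ω => K t ω - K s ω) (poissonMeasure (r * (t - s))) P := by
    intro s t hst
    refine ⟨hD s t, (MeasurableEmbedding.natCast (α := ℝ)).map_injective ?_⟩
    refine Measure.ext_of_charFun (funext fun θ => ?_)
    rw [charFun_map_cast_poissonMeasure, ← hchar s t hst,
      AEMeasurable.map_map_of_aemeasurable (by fun_prop) (hD s t)]
    rfl
  refine ⟨fun n t ht => ?_, hlaw⟩
  have hindep : iIndepFun (fun (i : Fin n) ω =>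
      ((K (t i.succ) ω - K (t i.castSucc) ω : ℕ) : ℝ)) P := by
    refine (iIndepFun_iff_charFun_pi fun i => hDR _ _).2 fun θ => ?_
    have h1 := h n t ht (fun i => cexp (θ i * I)) fun i => norm_exp_ofReal_mul_I _
    rw [Finset.prod_congr rfl fun i _ => hchar _ _ (ht i.castSucc_lt_succ.le) (θ i), ← h1,
      charFun_apply, integral_map]
    · refine integral_congr_ae (Filter.Eventually.of_forall fun ω => ?_)
      simp only [PiLp.inner_apply, Real.inner_apply]
      push_cast
      rw [Finset.sum_mul, Complex.exp_sum]
      exact Finset.prod_congr rfl fun i _ => by rw [← hexp]; push_cast; rfl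
    · exact (WithLp.measurable_toLp 2 _).comp_aemeasurable (aemeasurable_pi_lambda _ fun i => hDR _ _)
    · fun_prop
  -- The floor undoes the cast to `ℝ`, made only in order to use characteristic functions.
  have := hindep.comp (fun _ x => ⌊x⌋₊) fun _ => Nat.measurable_floor
  convert this using 3 with i ω
  simp

end PoissonTransform

/-! ### Independent thinning of a Poisson process. -/

section Thinning

theorem ncard_le_sub_ncard_le {τ : ℕ → ℝ} {s t : ℝ} (hst : s ≤ t) (ht : {k | τ k ≤ t}.Finite)
    (S : Set ℕ) :
    {k | τ k ≤ t ∧ k ∈ S}.ncard - {k | τ k ≤ s ∧ k ∈ S}.ncard =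
      {k | (s < τ k ∧ τ k ≤ t) ∧ k ∈ S}.ncard := by
  have hsub : {k | τ k ≤ s ∧ k ∈ S} ⊆ {k | τ k ≤ t ∧ k ∈ S} := fun k hk => ⟨hk.1.trans hst, hk.2⟩
  have hfin : {k | τ k ≤ t ∧ k ∈ S}.Finite := ht.subset fun k hk => hk.1
  rw [← Set.ncard_sdiff' hsub hfin]
  congr 1
  ext k
  simp only [Set.mem_sdiff, Set.mem_ofPred_eq, ← not_le]
  tauto

variable (ν : Measure ℝ) [IsProbabilityMeasure ν] {M : Set ℝ}

open Classical in
theorem integral_prod_ite_infinitePi (hM : MeasurableSet M) (c : ℕ → ℂ) (J : Finset ℕ) :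
    ∫ u, ∏ k ∈ J, (if u k ∈ M then c k else 1) ∂(Measure.infinitePi fun _ : ℕ => ν) =
      ∏ k ∈ J, (1 + ν.real M * (c k - 1)) := by
  have hf : ∀ k, Measurable fun x : ℝ => if x ∈ M then c k else 1 := fun k =>
    Measurable.ite hM measurable_const measurable_const
  have hind : iIndepFun (fun (k : J) (u : ℕ → ℝ) => u k) (Measure.infinitePi fun _ : ℕ => ν) :=
    (iIndepFun_infinitePi (X := fun _ x => x) fun _ => measurable_id).precomp
      Subtype.val_injective
  simp only [← Finset.prod_coe_sort J]
  rw [hind.integral_fun_prod_comp (f := fun (k : J) x => if x ∈ M then c k else 1)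
    (fun k => (measurable_pi_apply _).aemeasurable) fun k => (hf k).aestronglyMeasurable]
  refine Finset.prod_congr rfl fun k _ => ?_
  rw [← integral_map (μ := Measure.infinitePi fun _ : ℕ => ν) (φ := fun u => u k)
    (f := fun x => if x ∈ M then c k else 1) (measurable_pi_apply _).aemeasurable
    (hf k).aestronglyMeasurable,
    Measure.infinitePi_map_eval]
  have : (fun x : ℝ => if x ∈ M then c k else 1) =
      fun x => 1 + M.indicator (fun _ => c k - 1) x := by
    ext x
    by_cases hx : x ∈ M <;> simp [hx]
  rw [this, integral_add (integrable_const _) ((integrable_const _).indicator hM),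
    integral_indicator_const _ hM]
  simp

open Classical in
/-- Disjoint sets of independently marked points: generating function of the numbers of marks. -/
theorem integral_prod_pow_marks {n : ℕ} (hM : MeasurableSet M) (z : Fin n → ℂ)
    (J : Fin n → Finset ℕ) (hJ : Pairwise fun i j => Disjoint (J i) (J j)) :
    ∫ u, ∏ i, z i ^ ((J i).filter fun k => u k ∈ M).card ∂(Measure.infinitePi fun _ : ℕ => ν) =
      ∏ i, (1 + ν.real M * (z i - 1)) ^ (J i).card := by
  -- By disjointness `c k` is the `z i` of the block containing `k`, which merges the blocks into
  -- one product over their union.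
  set c : ℕ → ℂ := fun k => ∏ i, if k ∈ J i then z i else 1
  have hc : ∀ i, ∀ k ∈ J i, c k = z i := fun i k hk => by
    rw [show c k = ∏ i, if k ∈ J i then z i else 1 from rfl, Finset.prod_eq_single i]
    · rw [if_pos hk]
    · exact fun j _ hji => if_neg fun hkj => Finset.disjoint_left.1 (hJ hji) hkj hk
    · exact fun h => absurd (Finset.mem_univ i) h
  have hdisj : ((Finset.univ : Finset (Fin n)) : Set (Fin n)).PairwiseDisjoint J :=
    fun i _ j _ hij => hJ hij
  have h := integral_prod_ite_infinitePi ν hM c (Finset.univ.biUnion J)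
  simp only [Finset.prod_biUnion hdisj] at h
  convert h using 2
  · ext u
    refine Finset.prod_congr rfl fun i _ => ?_
    rw [← Finset.prod_const, Finset.prod_filter]
    exact Finset.prod_congr rfl fun k hk => by rw [hc i k hk]
  · rw [← Finset.prod_const]
    exact Finset.prod_congr rfl fun k hk => by rw [hc _ k hk]

variable {μ : Measure (ℕ → ℝ)} [IsProbabilityMeasure μ] {r : ℝ≥0}

theorem measurable_ncard_marked (hM : MeasurableSet M) (t : ℝ) :
    Measurable fun x : (ℕ → ℝ) × (ℕ → ℝ) => {k | x.1 k ≤ t ∧ x.2 k ∈ M}.ncard := by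
  refine measurable_ncard.comp (measurable_set_iff.2 fun k => ?_)
  have h1 : MeasurableSet {x : (ℕ → ℝ) × (ℕ → ℝ) | x.1 k ≤ t} :=
    measurableSet_le (by fun_prop) measurable_const
  have h2 : MeasurableSet {x : (ℕ → ℝ) × (ℕ → ℝ) | x.2 k ∈ M} :=
    hM.preimage (by fun_prop)
  exact (measurableSet_setOfPred.1 h1).and (measurableSet_setOfPred.1 h2)

theorem continuousWithinAt_ncard_marked {τ : ℕ → ℝ} (hτ : ∀ t, {k | τ k ≤ t}.Finite) (S : Set ℕ)
    (t : ℝ≥0) :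
    ContinuousWithinAt (fun s : ℝ≥0 => {k | τ k ≤ s ∧ k ∈ S}.ncard) (Set.Ici t) t := by
  -- The cutoff `t + 1` leaves finitely many points to avoid.
  have hopen : ∀ᶠ s : ℝ≥0 in nhds t, ∀ k ∈ {k | τ k ≤ t + 1 ∧ (t : ℝ) < τ k}, (s : ℝ) < τ k :=
    (Filter.eventually_all_finite ((hτ (t + 1)).subset fun k hk => hk.1)).2 fun k hk =>
      (NNReal.continuous_coe.tendsto t).eventually (gt_mem_nhds hk.2)
  have hlt : ∀ᶠ s : ℝ≥0 in nhds t, (s : ℝ) < t + 1 :=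
    (NNReal.continuous_coe.tendsto t).eventually (gt_mem_nhds (lt_add_one _))
  refine tendsto_nhds_of_eventually_eq ?_
  filter_upwards [self_mem_nhdsWithin, nhdsWithin_le_nhds hopen, nhdsWithin_le_nhds hlt]
    with s hts hs hs1
  congr 1
  ext k
  refine and_congr_left fun _ => ⟨fun h => ?_, fun h => h.trans (NNReal.coe_le_coe.2 hts)⟩
  by_contra! hc
  exact absurd (hs k ⟨h.trans hs1.le, hc⟩) (not_lt.2 h)

/-- A sufficient condition for the counting process of a random set of points to be a Poisson
process. -/
theorem isPoissonProcess_ncard {Ω : Type*} [MeasurableSpace Ω] {P : Measure Ω}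
    [IsProbabilityMeasure P] {T : ℕ → Ω → ℝ} {S : Ω → Set ℕ}
    (hfin : ∀ᵐ ω ∂P, ∀ t : ℝ, {k | T k ω ≤ t}.Finite) (hpos : ∀ᵐ ω ∂P, ∀ k, 0 < T k ω)
    (hmeas : ∀ t : ℝ≥0, AEMeasurable (fun ω => {k | T k ω ≤ t ∧ k ∈ S ω}.ncard) P)
    (hint : ∀ (n : ℕ) (t : Fin (n + 1) → ℝ≥0), Monotone t → ∀ z : Fin n → ℂ, (∀ i, ‖z i‖ = 1) →
      ∫ ω, ∏ i, z i ^ ({k | T k ω ≤ t i.succ ∧ k ∈ S ω}.ncard -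
        {k | T k ω ≤ t i.castSucc ∧ k ∈ S ω}.ncard) ∂P =
        ∏ i : Fin n, Complex.exp ((r * (t i.succ - t i.castSucc) : ℝ≥0) * (z i - 1))) :
    IsPoissonProcess P r fun t ω => {k | T k ω ≤ t ∧ k ∈ S ω}.ncard := by
  have key := indepIncrements_and_law_of_integral_prod_pow hmeas hint
  refine ⟨hmeas, ?_, ?_, ?_, key.1, key.2⟩
  · filter_upwards [hpos] with ω hω
    convert Set.ncard_empty ℕ
    exact Set.eq_empty_of_forall_notMem fun k hk => absurd (hω k) (not_lt.2 hk.1)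
  · filter_upwards [hfin] with ω hω s t hst
    exact Set.ncard_le_ncard (fun k hk => ⟨hk.1.trans (NNReal.coe_le_coe.2 hst), hk.2⟩)
      ((hω t).subset fun k hk => hk.1)
  · filter_upwards [hfin] with ω hω t
    exact continuousWithinAt_ncard_marked hω (S ω) t

theorem IsPoissonProcess.arrival_pos {Ω : Type*} [MeasurableSpace Ω] {P : Measure Ω}
    {T : ℕ → Ω → ℝ} (h : IsPoissonProcess P r fun t ω => {k | T k ω ≤ (t : ℝ)}.ncard)
    (hfin : ∀ᵐ ω ∂P, ∀ t : ℝ, {k | T k ω ≤ t}.Finite) : ∀ᵐ ω ∂P, ∀ k, 0 < T k ω := by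
  filter_upwards [h.zero, hfin] with ω h0 hω k
  have := (Set.ncard_eq_zero (hω _)).1 h0
  by_contra! hk
  exact this.subset (show k ∈ {k | T k ω ≤ ((0 : ℝ≥0) : ℝ)} from hk)

theorem ae_map_finite {Ω : Type*} [MeasurableSpace Ω] {P : Measure Ω} {T : ℕ → Ω → ℝ}
    (hT : ∀ k, Measurable (T k)) (hfin : ∀ᵐ ω ∂P, ∀ t : ℝ, {k | T k ω ≤ t}.Finite) :
    ∀ᵐ τ ∂(P.map fun ω k => T k ω), ∀ t : ℝ, {k | τ k ≤ t}.Finite := by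
  have hmeas : ∀ n : ℕ, MeasurableSet {τ : ℕ → ℝ | {k | τ k ≤ (n : ℝ)}.Finite} := fun n => by
    have h1 : Measurable fun τ : ℕ → ℝ => {k | τ k ≤ (n : ℝ)} := measurable_set_iff.2 fun k =>
      measurableSet_setOfPred.1
        (show MeasurableSet {τ : ℕ → ℝ | τ k ≤ n} from measurableSet_le (by fun_prop) (by fun_prop))
    exact Set.Countable.measurableSet Set.Countable.ofPred_finite |>.preimage h1
  have h : ∀ᵐ τ ∂(P.map fun ω k => T k ω), ∀ n : ℕ, {k | τ k ≤ (n : ℝ)}.Finite := by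
    refine ae_all_iff.2 fun n => (ae_map_iff (measurable_pi_lambda _ hT).aemeasurable
      (hmeas n)).2 ?_
    filter_upwards [hfin] with ω hω using hω n
  filter_upwards [h] with τ hτ t
  obtain ⟨n, hn⟩ := exists_nat_ge t
  exact (hτ n).subset fun k hk => le_trans hk hn

theorem IsPoissonProcess.map_arrivals {Ω : Type*} [MeasurableSpace Ω] {P : Measure Ω}
    [IsProbabilityMeasure P] {T : ℕ → Ω → ℝ} (hT : ∀ k, Measurable (T k))
    (h : IsPoissonProcess P r fun t ω => {k | T k ω ≤ (t : ℝ)}.ncard)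
    (hfin : ∀ᵐ ω ∂P, ∀ t : ℝ, {k | T k ω ≤ t}.Finite) :
    IsPoissonProcess (P.map fun ω k => T k ω) r fun t τ => {k | τ k ≤ (t : ℝ)}.ncard := by
  have hTm : Measurable fun ω k => T k ω := measurable_pi_lambda _ hT
  have := Measure.isProbabilityMeasure_map (μ := P) hTm.aemeasurable
  have hmeas : ∀ t : ℝ≥0, Measurable fun τ : ℕ → ℝ => {k | τ k ≤ (t : ℝ)}.ncard := fun t =>
    measurable_ncard.comp (measurable_set_iff.2 fun k => measurableSet_setOfPred.1
      (show MeasurableSet {τ : ℕ → ℝ | τ k ≤ t} from measurableSet_le (by fun_prop) (by fun_prop)))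
  have hpos : ∀ᵐ τ ∂(P.map fun ω k => T k ω), ∀ k, 0 < τ k := by
    refine ae_all_iff.2 fun k => (ae_map_iff hTm.aemeasurable
      (measurableSet_lt (by fun_prop) (by fun_prop))).2 ?_
    filter_upwards [h.arrival_pos hfin] with ω hω using hω k
  have := isPoissonProcess_ncard (P := P.map fun ω k => T k ω) (r := r) (T := fun k τ => τ k)
    (S := fun _ => Set.univ) (ae_map_finite hT hfin) hpos
    (fun t => by simpa using (hmeas t).aemeasurable) fun n t ht z hz => by
      simp only [Set.mem_univ, and_true]
      rw [integral_map hTm.aemeasurable, h.integral_prod_pow ht]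
      exact (Finset.measurable_prod _ fun i _ =>
        (measurable_of_countable fun m : ℕ × ℕ => z i ^ (m.1 - m.2)).comp
          ((hmeas _).prodMk (hmeas _))).aestronglyMeasurable
  simpa using this

/-- Thinning of a Poisson process: if every point is independently marked with probability `ν M`,
then the marked points form a Poisson process. -/
theorem IsPoissonProcess.thinning
    (h : IsPoissonProcess μ r fun t τ => {k | τ k ≤ (t : ℝ)}.ncard)
    (hfin : ∀ᵐ τ ∂μ, ∀ t : ℝ, {k | τ k ≤ t}.Finite) (hM : MeasurableSet M) :
    IsPoissonProcess (μ.prod (Measure.infinitePi fun _ : ℕ => ν)) (r * (ν M).toNNReal)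
      fun t x => {k | x.1 k ≤ (t : ℝ) ∧ x.2 k ∈ M}.ncard := by
  classical
  set π := Measure.infinitePi fun _ : ℕ => ν
  set K : ℝ≥0 → (ℕ → ℝ) × (ℕ → ℝ) → ℕ := fun t x => {k | x.1 k ≤ (t : ℝ) ∧ x.2 k ∈ M}.ncard
  have hfin' : ∀ᵐ x ∂μ.prod π, ∀ t : ℝ, {k | x.1 k ≤ t}.Finite :=
    Measure.quasiMeasurePreserving_fst.ae hfin
  have hmeas : ∀ t, Measurable (K t) := fun t => measurable_ncard_marked hM t
  have hpos : ∀ᵐ x ∂μ.prod π, ∀ k, 0 < x.1 k :=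
    Measure.quasiMeasurePreserving_fst.ae (h.arrival_pos (T := fun k (τ : ℕ → ℝ) => τ k) hfin)
  have hint : ∀ (n : ℕ) (t : Fin (n + 1) → ℝ≥0), Monotone t → ∀ z : Fin n → ℂ,
      (∀ i, ‖z i‖ = 1) → ∫ x, ∏ i, z i ^ (K (t i.succ) x - K (t i.castSucc) x) ∂(μ.prod π) =
        ∏ i : Fin n, Complex.exp
          ((r * (ν M).toNNReal * (t i.succ - t i.castSucc) : ℝ≥0) * (z i - 1)) := by
    intro n t ht z hz
    have hbound : ∀ x, ‖∏ i, z i ^ (K (t i.succ) x - K (t i.castSucc) x)‖ ≤ 1 := fun x => by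
      simp [norm_prod, norm_pow, hz]
    have hmeas' : Measurable fun x => ∏ i, z i ^ (K (t i.succ) x - K (t i.castSucc) x) :=
      Finset.measurable_prod _ fun i _ =>
        (measurable_of_countable fun m : ℕ × ℕ => z i ^ (m.1 - m.2)).comp
          ((hmeas _).prodMk (hmeas _))
    rw [integral_prod _ (Integrable.of_bound hmeas'.aestronglyMeasurable 1
      (Filter.Eventually.of_forall hbound))]
    -- Given the points `τ`, each one contributes the generating function `1 + q (z i - 1)` of its
    -- mark, where `q = ν M`.
    have hinner : ∀ᵐ τ ∂μ, ∫ u, ∏ i, z i ^ (K (t i.succ) (τ, u) - K (t i.castSucc) (τ, u)) ∂π =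
        ∏ i : Fin n, (1 + ν.real M * (z i - 1)) ^
          ({k | τ k ≤ (t i.succ : ℝ)}.ncard - {k | τ k ≤ (t i.castSucc : ℝ)}.ncard) := by
      filter_upwards [hfin] with τ hτ
      have hJfin : ∀ i : Fin n, {k | (t i.castSucc : ℝ) < τ k ∧ τ k ≤ t i.succ}.Finite :=
        fun i => (hτ (t i.succ)).subset fun k hk => hk.2
      have hti : ∀ i : Fin n, (t i.castSucc : ℝ) ≤ t i.succ := fun i =>
        NNReal.coe_le_coe.2 (ht i.castSucc_lt_succ.le)
      have hlt : ∀ i j : Fin n, i < j → Disjoint (hJfin i).toFinset (hJfin j).toFinset := by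
        intro i j hij
        refine Finset.disjoint_left.2 fun k hki hkj => ?_
        simp only [Set.Finite.mem_toFinset, Set.mem_ofPred_eq] at hki hkj
        have : (t i.succ : ℝ) ≤ t j.castSucc :=
          NNReal.coe_le_coe.2 (ht (Fin.succ_le_castSucc_iff.2 hij))
        linarith
      have hcard : ∀ i : Fin n, {k | τ k ≤ (t i.succ : ℝ)}.ncard -
          {k | τ k ≤ (t i.castSucc : ℝ)}.ncard = (hJfin i).toFinset.card := fun i => by
        have := ncard_le_sub_ncard_le (hti i) (hτ _) Set.univ
        simp only [Set.mem_univ, and_true] at this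
        rw [this, Set.ncard_eq_toFinset_card _ (hJfin i)]
      simp only [hcard]
      rw [← integral_prod_pow_marks ν hM z (fun i => (hJfin i).toFinset) fun i j hij =>
        (lt_or_gt_of_ne hij).elim (hlt i j) fun h => (hlt j i h).symm]
      refine integral_congr_ae (Filter.Eventually.of_forall fun u => ?_)
      refine Finset.prod_congr rfl fun i _ => ?_
      congr 1
      refine (ncard_le_sub_ncard_le (hti i) (hτ _) {k | u k ∈ M}).trans ?_
      rw [← Set.ncard_coe_finset]
      congr 1
      ext k
      simp
    -- With `w = 1 + q (z - 1)` the exponent `r (w - 1)` becomes `r q (z - 1)`: a Poisson transform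
    -- of rate `r q`.
    rw [integral_congr_ae hinner, h.integral_prod_pow ht]
    refine Finset.prod_congr rfl fun i _ => ?_
    congr 1
    have : (ν.real M : ℂ) = ((ν M).toNNReal : ℝ) := rfl
    rw [this]
    push_cast
    ring
  exact isPoissonProcess_ncard (P := μ.prod π) (T := fun k (x : (ℕ → ℝ) × (ℕ → ℝ)) => x.1 k)
    (S := fun x => {k | x.2 k ∈ M}) hfin' hpos (fun t => (hmeas t).aemeasurable) hint

end Thinning

/-! ### The rate determines the law of the ordered points. -/

section Law

variable {Ω Ω' : Type*} [MeasurableSpace Ω] [MeasurableSpace Ω'] {P : Measure Ω} {P' : Measure Ω'}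
  {r : ℝ≥0} {N : ℝ≥0 → Ω → ℕ} {N' : ℝ≥0 → Ω' → ℕ}

/-- The finite-dimensional distributions of a Poisson process, in terms of Poisson measures. -/
theorem IsPoissonProcess.map_eval_eq (h : IsPoissonProcess P r N) {n : ℕ} {e : Fin n → ℝ≥0}
    (he : Monotone e) :
    P.map (fun ω i => N (e i) ω) =
      (Measure.pi fun i : Fin n => poissonMeasure
        (r * (e i - (Fin.cons 0 e : Fin (n + 1) → ℝ≥0) i.castSucc))).map
      fun d i => ∑ j ∈ Finset.univ.filter (fun j : Fin n => j.castSucc < i.succ), d j := by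
  -- Time `0` is prepended so that, since the process starts in `0`, its values are partial sums of
  -- increments.
  set t : Fin (n + 1) → ℝ≥0 := Fin.cons 0 e
  have ht : Monotone t := Fin.monotone_iff_le_succ.2 fun i => by
    rcases n with _ | n
    · exact i.elim0
    · refine Fin.cases ?_ (fun j => ?_) i
      · simp [t]
      · rw [← Fin.succ_castSucc]
        simp only [t, Fin.cons_succ]
        exact he j.castSucc_lt_succ.le
  have hlaw : ∀ i : Fin n, HasLaw (fun ω => N (t i.succ) ω - N (t i.castSucc) ω)
      (poissonMeasure (r * (t i.succ - t i.castSucc))) P := fun i =>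
    h.increment_law _ _ (ht i.castSucc_lt_succ.le)
  have hD : P.map (fun ω (i : Fin n) => N (t i.succ) ω - N (t i.castSucc) ω) =
      Measure.pi fun i : Fin n => poissonMeasure (r * (t i.succ - t i.castSucc)) := by
    rw [(h.indepIncrements n t ht).map_fun_eq_pi_map fun i => (hlaw i).aemeasurable]
    congr with i : 1
    exact (hlaw i).map_eq
  have hsucc : ∀ i : Fin n, t i.succ = e i := fun i => by simp [t]
  simp only [hsucc] at hD
  rw [← hD, AEMeasurable.map_map_of_aemeasurable (measurable_of_countable _).aemeasurable
    (aemeasurable_pi_lambda _ fun i => by simpa only [hsucc] using (hlaw i).aemeasurable)]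
  refine Measure.map_congr ?_
  filter_upwards [h.zero, h.monotone] with ω h0 hmono
  have key : ∀ i : Fin (n + 1), N (t i) ω =
      ∑ j ∈ Finset.univ.filter (fun j : Fin n => j.castSucc < i),
        (N (t j.succ) ω - N (t j.castSucc) ω) := by
    intro i
    refine Fin.induction ?_ (fun i ih => ?_) i
    · simpa [t] using h0
    · have : Finset.univ.filter (fun j : Fin n => j.castSucc < i.succ) =
          insert i (Finset.univ.filter fun j : Fin n => j.castSucc < i.castSucc) := by
        ext j
        simp only [Finset.mem_filter, Finset.mem_univ, true_and, Finset.mem_insert]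
        rw [Fin.castSucc_lt_succ_iff, Fin.castSucc_lt_castSucc_iff, le_iff_eq_or_lt]
      rw [this, Finset.sum_insert (by simp), ← ih]
      have hle : N (t i.castSucc) ω ≤ N (t i.succ) ω := hmono (ht i.castSucc_lt_succ.le)
      omega
  ext i
  have := key i.succ
  simp only [hsucc] at this
  exact this

theorem IsPoissonProcess.map_restrict_rat_eq (h : IsPoissonProcess P r N) (I : Finset ℚ) :
    P.map (fun ω => I.restrict fun q : ℚ => N (Real.toNNReal q) ω) =
      (P.map fun ω i => N (Real.toNNReal (I.orderEmbOfFin rfl i)) ω).map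
        fun x q => x ((I.orderIsoOfFin rfl).symm q) := by
  rw [AEMeasurable.map_map_of_aemeasurable (measurable_of_countable _).aemeasurable
    (aemeasurable_pi_lambda _ fun i => h.aemeasurable _)]
  congr 1
  ext ω q
  have : I.orderEmbOfFin rfl ((I.orderIsoOfFin rfl).symm q) = (q : ℚ) := by
    rw [← Finset.coe_orderIsoOfFin_apply, OrderIso.apply_symm_apply]
  simp only [Finset.restrict, Function.comp_apply, this]

/-- The law of a Poisson process at rational times is determined by its rate. -/
theorem IsPoissonProcess.map_rat_eq [IsProbabilityMeasure P] [IsProbabilityMeasure P']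
    (h : IsPoissonProcess P r N) (h' : IsPoissonProcess P' r N') :
    P.map (fun ω (q : ℚ) => N (Real.toNNReal q) ω) =
      P'.map fun ω (q : ℚ) => N' (Real.toNNReal q) ω := by
  have hmono : ∀ I : Finset ℚ, Monotone fun i => Real.toNNReal (I.orderEmbOfFin rfl i) :=
    fun I i j hij => Real.toNNReal_mono (Rat.cast_le.2 ((I.orderEmbOfFin rfl).monotone hij))
  have hlim := isProjectiveLimit_map (X := fun (q : ℚ) ω => N (Real.toNNReal q) ω)
    (aemeasurable_pi_lambda _ fun q => h.aemeasurable _)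
  have hlim' := isProjectiveLimit_map (X := fun (q : ℚ) ω => N' (Real.toNNReal q) ω)
    (aemeasurable_pi_lambda _ fun q => h'.aemeasurable _)
  have heq : (fun I : Finset ℚ => P.map fun ω => I.restrict fun q : ℚ => N (Real.toNNReal q) ω) =
      fun I => P'.map fun ω => I.restrict fun q : ℚ => N' (Real.toNNReal q) ω := by
    ext1 I
    rw [h.map_restrict_rat_eq I, h'.map_restrict_rat_eq I, h.map_eval_eq (hmono I),
      h'.map_eval_eq (hmono I)]
  rw [heq] at hlim
  exact hlim.unique hlim'

open Classical in
/-- The points of a counting process, recovered from its values at rational times. -/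
noncomputable def arrivalsOfCount (x : ℚ → ℕ) (k : ℕ) : ℝ :=
  (⨅ q : ℚ, if k < x q then ((Real.toNNReal q : ℝ≥0) : ℝ≥0∞) else ∞).toReal

theorem measurable_arrivalsOfCount : Measurable arrivalsOfCount := by
  classical
  refine measurable_pi_lambda _ fun k => ENNReal.measurable_toReal.comp (Measurable.iInf fun q => ?_)
  exact Measurable.ite (measurableSet_lt measurable_const (measurable_pi_apply q))
    measurable_const measurable_const

/-- For ordered points, `τ k ≤ t` means that more than `k` points lie in `(-∞, t]`, so `τ k` is the
infimum of the rational times whose count exceeds `k`. -/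
theorem arrivalsOfCount_ncard {τ : ℕ → ℝ} (hmono : Monotone τ) (hfin : ∀ t, {k | τ k ≤ t}.Finite)
    (hpos : ∀ k, 0 < τ k) :
    arrivalsOfCount (fun q => {k | τ k ≤ (Real.toNNReal q : ℝ)}.ncard) = τ := by
  classical
  have hiff : ∀ (t : ℝ) k, k < {k | τ k ≤ t}.ncard ↔ τ k ≤ t := fun t k => by
    constructor
    · intro h
      by_contra! hc
      have hsub : {k | τ k ≤ t} ⊆ Finset.range k := fun j hj => by
        rw [Finset.coe_range, Set.mem_Iio]
        by_contra! hkj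
        exact absurd ((hmono hkj).trans hj) (not_le.2 hc)
      have := Set.ncard_le_ncard hsub (Finset.finite_toSet _)
      rw [Set.ncard_coe_finset, Finset.card_range] at this
      omega
    · intro h
      have hsub : (Finset.range (k + 1) : Set ℕ) ⊆ {k | τ k ≤ t} := fun j hj => by
        rw [Finset.coe_range, Set.mem_Iio] at hj
        exact (hmono (Nat.lt_succ_iff.1 hj)).trans h
      have := Set.ncard_le_ncard hsub (hfin t)
      rw [Set.ncard_coe_finset, Finset.card_range] at this
      omega
  ext k
  simp only [arrivalsOfCount, hiff]
  refine Eq.trans ?_ (ENNReal.toReal_ofReal (hpos k).le)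
  congr 1
  refine le_antisymm (le_of_forall_gt fun c hc => ?_) (le_iInf fun q => ?_)
  · obtain ⟨q, -, h1, h2⟩ := ENNReal.lt_iff_exists_rat_btwn.1 hc
    refine (iInf_le _ q).trans_lt ?_
    rw [if_pos]
    · exact h2
    · have := (ENNReal.ofReal_lt_coe_iff (hpos k).le).1 h1
      exact this.le
  · split_ifs with h
    · rw [← ENNReal.ofReal_coe_nnreal]
      exact ENNReal.ofReal_le_ofReal h
    · exact le_top

theorem IsPoissonProcess.map_arrivals_eq_map_arrivalsOfCount {T : ℕ → Ω → ℝ}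
    (h : IsPoissonProcess P r fun t ω => {k | T k ω ≤ (t : ℝ)}.ncard)
    (hmono : ∀ᵐ ω ∂P, Monotone fun k => T k ω)
    (hfin : ∀ᵐ ω ∂P, ∀ t : ℝ, {k | T k ω ≤ t}.Finite) :
    P.map (fun ω k => T k ω) =
      (P.map fun ω (q : ℚ) => {k | T k ω ≤ (Real.toNNReal q : ℝ)}.ncard).map
        arrivalsOfCount := by
  rw [AEMeasurable.map_map_of_aemeasurable measurable_arrivalsOfCount.aemeasurable
    (aemeasurable_pi_lambda _ fun q => h.aemeasurable _)]
  refine Measure.map_congr ?_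
  filter_upwards [hmono, hfin, h.arrival_pos hfin] with ω h1 h2 h3
  exact (arrivalsOfCount_ncard h1 h2 h3).symm

/-- The law of the points of a Poisson process is determined by its rate. -/
theorem IsPoissonProcess.map_arrivals_eq [IsProbabilityMeasure P] [IsProbabilityMeasure P']
    {T : ℕ → Ω → ℝ} {T' : ℕ → Ω' → ℝ}
    (h : IsPoissonProcess P r fun t ω => {k | T k ω ≤ (t : ℝ)}.ncard)
    (h' : IsPoissonProcess P' r fun t ω => {k | T' k ω ≤ (t : ℝ)}.ncard)
    (hmono : ∀ᵐ ω ∂P, Monotone fun k => T k ω) (hmono' : ∀ᵐ ω ∂P', Monotone fun k => T' k ω)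
    (hfin : ∀ᵐ ω ∂P, ∀ t : ℝ, {k | T k ω ≤ t}.Finite)
    (hfin' : ∀ᵐ ω ∂P', ∀ t : ℝ, {k | T' k ω ≤ t}.Finite) :
    P.map (fun ω k => T k ω) = P'.map fun ω k => T' k ω := by
  rw [h.map_arrivals_eq_map_arrivalsOfCount hmono hfin,
    h'.map_arrivals_eq_map_arrivalsOfCount hmono' hfin', h.map_rat_eq h']

end Law

/-! ### The M/G/1 FB queue driven by arrivals and uniform variables. -/

section MG1

variable {Ω : Type*} [MeasurableSpace Ω] {P : Measure Ω} {lam : ℝ≥0}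
  {F : Measure ℝ} {T B : ℕ → Ω → ℝ} {A : ℕ → ℝ → Ω → ℝ}

theorem IsMG1FB.maxProcess_ae_eq (h : IsMG1FB P lam F T B A) :
    maxProcess T B A =ᵐ[P]
      fun ω (t : ℝ≥0) => maxAtArrivals (fun k => T k ω) (fun k => B k ω) t := by
  filter_upwards [h.discipline, h.arrival_locallyFinite,
    h.arrival_poisson.arrival_pos h.arrival_locallyFinite,
    ae_all_iff.2 h.service_nonneg] with ω hA hfin hpos hB
  exact funext fun t => hA.maxQueueLength_eq hfin hpos hB t

theorem IsMG1FB.map_arrival_service [IsProbabilityMeasure P] [IsProbabilityMeasure F]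
    (h : IsMG1FB P lam F T B A) :
    P.map (fun ω => ((fun k => T k ω), fun k => B k ω)) =
      (P.map fun ω k => T k ω).prod (Measure.infinitePi fun _ => F) := by
  have hT : Measurable fun ω k => T k ω := measurable_pi_lambda _ h.measurable_arrival
  have hB : Measurable fun ω k => B k ω := measurable_pi_lambda _ h.measurable_service
  rw [h.arrival_indep_service.map_prod_eq_prod_map_map hT.aemeasurable hB.aemeasurable,
    (h.service_indep.hasLaw_infinitePi h.service_law hB.aemeasurable).map_eq]

/-- The maximum queue length process can be built from arrival times and independent uniform random
variables, transformed into service times by the quantile function. -/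
theorem IsMG1FB.identDistrib_maxAtArrivals [IsProbabilityMeasure P] [IsProbabilityMeasure F]
    (h : IsMG1FB P lam F T B A) :
    IdentDistrib
      (fun (x : (ℕ → ℝ) × (ℕ → ℝ)) (t : ℝ≥0) =>
        maxAtArrivals x.1 (fun k => quantile F (x.2 k)) t)
      (maxProcess T B A)
      ((P.map fun ω k => T k ω).prod (Measure.infinitePi fun _ => uniform01)) P := by
  have hT : Measurable fun ω k => T k ω := measurable_pi_lambda _ h.measurable_arrival
  have hB : Measurable fun ω k => B k ω := measurable_pi_lambda _ h.measurable_service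
  have := Measure.isProbabilityMeasure_map (μ := P) hT.aemeasurable
  have hq : Measurable fun (u : ℕ → ℝ) k => quantile F (u k) :=
    measurable_pi_lambda _ fun k => (measurable_quantile F).comp (measurable_pi_apply k)
  have hmap : ((P.map fun ω k => T k ω).prod (Measure.infinitePi fun _ : ℕ => uniform01)).map
      (Prod.map id fun u k => quantile F (u k)) =
      P.map fun ω => ((fun k => T k ω), fun k => B k ω) := by
    rw [← Measure.map_prod_map _ _ measurable_id hq, Measure.map_id,
      Measure.infinitePi_map_pi _ (f := fun _ => quantile F) fun _ => measurable_quantile F,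
      h.map_arrival_service]
    simp only [map_quantile_uniform01]
  refine ⟨(measurable_maxAtArrivals.comp (measurable_id.prodMap hq)).aemeasurable,
    (measurable_maxAtArrivals.comp (hT.prodMk hB)).aemeasurable.congr
      h.maxProcess_ae_eq.symm, ?_⟩
  rw [Measure.map_congr h.maxProcess_ae_eq]
  calc _ = (((P.map fun ω k => T k ω).prod (Measure.infinitePi fun _ : ℕ => uniform01)).map
      (Prod.map id fun u k => quantile F (u k))).map
        (fun x (t : ℝ≥0) => maxAtArrivals x.1 x.2 t) := by
        rw [Measure.map_map measurable_maxAtArrivals (measurable_id.prodMap hq)]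
        rfl
    _ = _ := by
        rw [hmap, Measure.map_map measurable_maxAtArrivals (hT.prodMk hB)]
        rfl

end MG1

end FBQueue

/-! ### The coupling of the two queues. -/

open FBQueue in
theorem theorem5p1 {ΩF ΩG : Type*} [MeasurableSpace ΩF] [MeasurableSpace ΩG]
    (PF : Measure ΩF) [IsProbabilityMeasure PF] (PG : Measure ΩG) [IsProbabilityMeasure PG]
    (lam : ℝ≥0) (hlam : 0 < lam)
    (F G : Measure ℝ) [IsProbabilityMeasure F] [IsProbabilityMeasure G]
    (p : ℝ≥0) (hp0 : 0 < p) (hp1 : p < 1)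
    (hFG : ∀ x : ℝ, min (cdf F x) (p : ℝ) = min (cdf G x) (p : ℝ))
    (TF BF : ℕ → ΩF → ℝ) (AF : ℕ → ℝ → ΩF → ℝ) (hF : IsMG1FB PF lam F TF BF AF)
    (TG BG : ℕ → ΩG → ℝ) (AG : ℕ → ℝ → ΩG → ℝ) (hG : IsMG1FB PG lam G TG BG AG) :
    ∃ (Ω : Type) (_ : MeasurableSpace Ω) (P : Measure Ω) (_ : IsProbabilityMeasure P)
      (MF MG : Ω → ℝ≥0 → ℕ∞) (K : ℝ≥0 → Ω → ℕ),
      IdentDistrib MF (maxProcess TF BF AF) P PF ∧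
      IdentDistrib MG (maxProcess TG BG AG) P PG ∧
      IsPoissonProcess P (lam * (1 - p)) K ∧
      (∀ᵐ ω ∂P, ∀ t : ℝ≥0, MF ω t ≤ MG ω t + (K t ω : ℕ∞)) ∧
      ∀ t : ℝ≥0, StochLE PF P (fun ω => maxProcess TF BF AF ω t)
        (fun ω => MG ω t + (K t ω : ℕ∞)) := by

  have hTF : Measurable fun ω k => TF k ω := measurable_pi_lambda _ hF.measurable_arrival
  have hprob := Measure.isProbabilityMeasure_map (μ := PF) hTF.aemeasurable
  have hTG : PG.map (fun ω k => TG k ω) = PF.map fun ω k => TF k ω :=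
    hG.arrival_poisson.map_arrivals_eq hF.arrival_poisson hG.arrival_monotone
      hF.arrival_monotone hG.arrival_locallyFinite hF.arrival_locallyFinite
  have hMF := hF.identDistrib_maxAtArrivals
  have hMG := hG.identDistrib_maxAtArrivals
  rw [hTG] at hMG
  set P := (PF.map fun ω k => TF k ω).prod (Measure.infinitePi fun _ : ℕ => uniform01)
  -- `K` counts the long customers, those with uniform variable at least `p`; they need not have the
  -- same service time in both queues.
  set K : ℝ≥0 → (ℕ → ℝ) × (ℕ → ℝ) → ℕ :=
    fun t x => {k | x.1 k ≤ (t : ℝ) ∧ x.2 k ∈ Set.Ici (p : ℝ)}.ncard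
  have hfin := ae_map_finite hF.measurable_arrival hF.arrival_locallyFinite
  have hmark : (uniform01 (Set.Ici (p : ℝ))).toNNReal = 1 - p := by
    have : Set.Ici (p : ℝ) ∩ Set.Ioo 0 1 = Set.Ico (p : ℝ) 1 := by
      ext u
      exact ⟨fun h => ⟨h.1, h.2.2⟩, fun h => ⟨h.1, (NNReal.coe_pos.2 hp0).trans_le h.1, h.2⟩⟩
    rw [uniform01, Measure.restrict_apply measurableSet_Ici, this, Real.volume_Ico]
    ext
    rw [ENNReal.coe_toNNReal_eq_toReal, ENNReal.toReal_ofReal (sub_nonneg.2 (by exact_mod_cast hp1.le)),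
      NNReal.coe_sub hp1.le, NNReal.coe_one]
  have hK : IsPoissonProcess P (lam * (1 - p)) K := by
    rw [← hmark]
    exact (hF.arrival_poisson.map_arrivals hF.measurable_arrival
      hF.arrival_locallyFinite).thinning uniform01 hfin measurableSet_Ici
  have hle : ∀ᵐ x ∂P, ∀ t : ℝ≥0, maxAtArrivals x.1 (fun k => quantile F (x.2 k)) t ≤
      maxAtArrivals x.1 (fun k => quantile G (x.2 k)) t + (K t x : ℕ∞) := by
    have hu : ∀ᵐ u ∂(Measure.infinitePi fun _ : ℕ => uniform01),
        ∀ k, u k ∈ Set.Ioo (0 : ℝ) 1 := ae_all_iff.2 fun k =>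
      (measurePreserving_eval_infinitePi (fun _ : ℕ => uniform01) k).quasiMeasurePreserving.ae
        ae_uniform01
    filter_upwards [Measure.quasiMeasurePreserving_fst.ae hfin,
      Measure.quasiMeasurePreserving_snd.ae hu] with x hx hu t
    rw [Set.Finite.cast_ncard_eq ((hx t).subset fun k hk => hk.1)]
    refine maxAtArrivals_le_add (S := {k | x.2 k ∈ Set.Ici (p : ℝ)}) (fun k hk => ?_)
      (fun k hk j hj => ?_) t
    · exact quantile_congr hFG (hu k) (not_le.1 hk).le
    · have hkj : x.2 k ≤ x.2 j := (not_le.1 hk).le.trans hj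
      exact ⟨quantile_mono (hu k) (hu j) hkj, quantile_mono (hu k) (hu j) hkj⟩
  refine ⟨(ℕ → ℝ) × (ℕ → ℝ), inferInstance, P, inferInstance, _, _, K, hMF, hMG, hK, hle,
    fun t x => ?_⟩
  -- The stochastic order at a fixed time needs only the marginal law of the coupled process and the
  -- almost sure inequality.
  have heq := (hMF.comp (measurable_pi_apply t)).measure_mem_eq
    (MeasurableSet.of_discrete (s := Set.Ioi x))
  refine heq.symm.trans_le (measure_mono_ae ?_)
  filter_upwards [hle] with ω hω h
  exact lt_of_lt_of_le h (hω t)
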